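/- Let $R$ be a noetherian integral domain with fraction field $K$, and let $A$ be an $R$-algebra (associative, unital, not necessarily commutative) which is finitely generated and free as an $R$-module. For a commutative $R$-algebra $S$ put $A^S = S\otimes_R A$; for a prime $\mathfrak p$ of $R$ with residue field $k(\mathfrak p)=\mathrm{Frac}(R/\mathfrak p)$ put $A(\mathfrak p)=k(\mathfrak p)\otimes_R A$. For a finite-dimensional algebra $B$ over a field let $G_0(B)$ be the Grothendieck group of the category of finite-dimensional $B$-modules. Let $\mathfrak p\in\mathrm{Spec}(R)$, and let $\mathcal O$ be a local ring with $R\subseteq\mathcal O\subseteq K$, with maximal ideal $\mathfrak m$ and residue field $k(\mathfrak m)$, such that $R\cap\mathfrak m=\mathfrak p$. Scalar extension along $k(\mathfrak p)\hookrightarrow k(\mathfrak m)$ gives a homomorphism $\gamma\colon G_0(A(\mathfrak p))\to G_0(k(\mathfrak m)\otimes_R A)$, which is injective. An $\mathcal O$-free $A^{\mathcal O}$-form of a finite-dimensional $A^K$-module $V$ is an $A^{\mathcal O}$-module $\widetilde V$ which is free over $\mathcal O$ and satisfies $K\otimes_{\mathcal O}\widetilde V\cong V$ as $A^K$-modules.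 The ring $\mathcal O$ is called an *$A$-gate* in $\mathfrak p$ if 1. every finite-dimensional $A^K$-module has an $\mathcal O$-free $A^{\mathcal O}$-form, and 2. for every finitely generated $\mathcal O$-free $A^{\mathcal O}$-module $\widetilde V$ the class $[\widetilde V/\mathfrak m\widetilde V]\in G_0(k(\mathfrak m)\otimes_R A)$ lies in the image of $\gamma$. If $\mathcal O$ is an $A$-gate in $\mathfrak p$, the *decomposition map* $d_A^{\mathfrak p,\mathcal O}\colon G_0(A^K)\to G_0(A(\mathfrak p))$ is the unique group homomorphism with $\gamma\bigl(d_A^{\mathfrak p,\mathcal O}([V])\bigr)=[\widetilde V/\mathfrak m\widetilde V]$ for every finite-dimensional $A^K$-module $V$ and every $\mathcal O$-free $A^{\mathcal O}$-form $\widetilde V$ of $V$. It is called *trivial* if it maps the set of classes of simple $A^K$-modules bijectively onto the set of classes of simple $A(\mathfrak p)$-modules; equivalently, the decomposition matrix, i.e. the matrix of $d_A^{\mathfrak p,\mathcal O}$ with respect to the bases of classes of simple modules, is a permutation matrix. Let $\mathrm{DecGen}(A)$ be the set of all $\mathfrak p\in\mathrm{Spec}(R)$ such that there is an $A$-gate in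 $\mathfrak p$ and for every $A$-gate $\mathcal O$ in $\mathfrak p$ the map $d_A^{\mathfrak p,\mathcal O}$ exists, is unique, and is trivial. **Theorem.** Suppose that $A^K$ splits, i.e. that $A^K/\mathrm{Jac}(A^K)$ is isomorphic as a $K$-algebra to a finite direct product of full matrix algebras over $K$. Then $\mathrm{DecGen}(A)$ contains an open subset of $\mathrm{Spec}(R)$ that contains the generic point $(0)$. In other words, decomposition matrices are generically trivial. -/

import Mathlib

open scoped TensorProduct

universe u v w w'

namespace DecompositionMaps

noncomputable section

section Grothendieck

variable (B : Type w) [Ring B]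

/-- The relations `[Y] - ([X] + [Z])`, one for every short exact sequence `0 → X → Y → Z → 0` of
finitely generated `B`-modules. -/
def shortExactRelations : Set (FreeAbelianGroup (FGModuleCat.{w'} B)) :=
  {r | ∃ (X Y Z : FGModuleCat.{w'} B) (f : X →ₗ[B] Y) (g : Y →ₗ[B] Z),
    Function.Injective f ∧ Function.Exact f g ∧ Function.Surjective g ∧
    r = FreeAbelianGroup.of Y - (FreeAbelianGroup.of X + FreeAbelianGroup.of Z)}

/-- The Grothendieck group `G₀(B)` of the category of finitely generated `B`-modules. For a
finite-dimensional algebra `B` over a field these are the finite-dimensional `B`-modules. -/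
def G0 : Type _ :=
  FreeAbelianGroup (FGModuleCat.{w'} B) ⧸ AddSubgroup.closure (shortExactRelations.{w, w'} B)

instance : AddCommGroup (G0.{w, w'} B) :=
  inferInstanceAs (AddCommGroup (_ ⧸ AddSubgroup.closure (shortExactRelations.{w, w'} B)))

variable {B}

/-- The class `[M]` of a finitely generated module in the Grothendieck group. -/
def G0.cls (M : FGModuleCat.{w'} B) : G0.{w, w'} B :=
  QuotientAddGroup.mk (FreeAbelianGroup.of M)

/-- A map on finitely generated modules that is additive on short exact sequences induces a
homomorphism on the Grothendieck group. -/
def G0.lift {H : Type*} [AddCommGroup H] (φ : FGModuleCat.{w'} B → H)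
    (hφ : ∀ (X Y Z : FGModuleCat.{w'} B) (f : X →ₗ[B] Y) (g : Y →ₗ[B] Z),
      Function.Injective f → Function.Exact f g → Function.Surjective g →
      φ Y = φ X + φ Z) : G0.{w, w'} B →+ H :=
  QuotientAddGroup.lift _ (FreeAbelianGroup.lift φ) <| by
    rw [AddSubgroup.closure_le]
    rintro _ ⟨X, Y, Z, f, g, hf, hfg, hg, rfl⟩
    simp [hφ X Y Z f g hf hfg hg]

theorem G0.lift_cls {H : Type*} [AddCommGroup H] (φ : FGModuleCat.{w'} B → H)
    (hφ : ∀ (X Y Z : FGModuleCat.{w'} B) (f : X →ₗ[B] Y) (g : Y →ₗ[B] Z),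
      Function.Injective f → Function.Exact f g → Function.Surjective g →
      φ Y = φ X + φ Z) (M : FGModuleCat.{w'} B) : G0.lift φ hφ (G0.cls M) = φ M := by
  change FreeAbelianGroup.lift φ (FreeAbelianGroup.of M) = φ M
  simp

theorem G0.cls_eq_add (X Y Z : FGModuleCat.{w'} B) (f : X →ₗ[B] Y) (g : Y →ₗ[B] Z)
    (hf : Function.Injective f) (hfg : Function.Exact f g) (hg : Function.Surjective g) :
    G0.cls Y = G0.cls X + G0.cls Z := by
  have h : (QuotientAddGroup.mk (FreeAbelianGroup.of Y -
      (FreeAbelianGroup.of X + FreeAbelianGroup.of Z)) : G0.{w, w'} B) = 0 :=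
    (QuotientAddGroup.eq_zero_iff _).mpr
      (AddSubgroup.subset_closure ⟨X, Y, Z, f, g, hf, hfg, hg, rfl⟩)
  exact sub_eq_zero.mp h

variable (B) in
/-- The classes in `G₀(B)` of the simple `B`-modules. -/
def simpleClasses : Set (G0.{w, w'} B) :=
  {x | ∃ S : FGModuleCat.{w'} B, IsSimpleModule B S ∧ G0.cls S = x}

end Grothendieck

/-- A finite-dimensional algebra `B` over a field `k` splits if `B / Jac(B)` is a finite direct
product of full matrix algebras over `k`. -/
def Splits (k : Type w) (B : Type w') [Field k] [Ring B] [Algebra k B] : Prop :=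
  ∃ (n : ℕ) (d : Fin n → ℕ), (∀ i, d i ≠ 0) ∧
    Nonempty ((B ⧸ Ring.jacobson B) ≃ₐ[k] (∀ i, Matrix (Fin (d i)) (Fin (d i)) k))

section BaseChange

variable {R : Type u} [CommRing R] (A : Type v) [Ring A] [Algebra R A]

variable (S : Type u) [CommRing S] [Algebra R S]

variable (T : Type u) [CommRing T] [Algebra R T] [Algebra S T] [IsScalarTower R S T]
variable (V : Type w) [AddCommGroup V] [Module S V] [Module (S ⊗[R] A) V]
  [IsScalarTower S (S ⊗[R] A) V]

/-- The action `t ⊗ a ↦ (t' ⊗ v ↦ t t' ⊗ (1 ⊗ a) v)` of `A^T` on `T ⊗_S V`, for an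
`A^S`-module `V`. -/
def baseChangeAction : T ⊗[R] A →ₐ[T] Module.End T (T ⊗[S] V) :=
  AlgHom.liftEquiv R T A _ <|
    (((Module.End.baseChangeHom S T V).comp
      (Algebra.lsmul S S V : S ⊗[R] A →ₐ[S] Module.End S V)).restrictScalars R).comp
      Algebra.TensorProduct.includeRight

theorem baseChangeAction_tmul (t t' : T) (a : A) (x : V) :
    baseChangeAction A S T V (t ⊗ₜ[R] a) (t' ⊗ₜ[S] x) =
      (t * t') ⊗ₜ[S] (((1 : S) ⊗ₜ[R] a : S ⊗[R] A) • x) := by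
  change t • LinearMap.baseChange T (Algebra.lsmul S S V ((1 : S) ⊗ₜ[R] a)) (t' ⊗ₜ[S] x) = _
  rw [LinearMap.baseChange_tmul, TensorProduct.smul_tmul', smul_eq_mul]
  rfl

theorem baseChangeAction_lTensor {V W : Type w} [AddCommGroup V] [Module S V]
    [Module (S ⊗[R] A) V] [IsScalarTower S (S ⊗[R] A) V] [AddCommGroup W] [Module S W]
    [Module (S ⊗[R] A) W] [IsScalarTower S (S ⊗[R] A) W] (f : V →ₗ[S ⊗[R] A] W)
    (b : T ⊗[R] A) (x : T ⊗[S] V) :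
    (f.restrictScalars S).lTensor T (baseChangeAction A S T V b x) =
      baseChangeAction A S T W b ((f.restrictScalars S).lTensor T x) := by
  induction b using TensorProduct.induction_on with
  | zero => simp
  | add b c hb hc => simp only [map_add, LinearMap.add_apply, hb, hc]
  | tmul t a =>
    induction x using TensorProduct.induction_on with
    | zero => simp
    | add x y hx hy => simp only [map_add, hx, hy]
    | tmul t' v => simp [baseChangeAction_tmul]

/-- The scalar extension `V^T = T ⊗_S V` of an `A^S`-module `V`; the parameters `R` and `A` only
record that the result is to be regarded as an `A^T`-module. -/
@[nolint unusedArguments]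
def ScalarExtension (_R : Type u) (_A : Type v) (S T : Type u) [CommRing S] [CommRing T]
    [Algebra S T] (V : Type w) [AddCommGroup V] [Module S V] : Type (max u w) :=
  T ⊗[S] V

instance : AddCommGroup (ScalarExtension R A S T V) :=
  inferInstanceAs (AddCommGroup (T ⊗[S] V))

/-- The `A^T`-module structure of `V^T`. -/
instance : Module (T ⊗[R] A) (ScalarExtension R A S T V) :=
  letI : Module (Module.End T (T ⊗[S] V)) (ScalarExtension R A S T V) :=
    inferInstanceAs (Module (Module.End T (T ⊗[S] V)) (T ⊗[S] V))
  Module.compHom _ (baseChangeAction A S T V).toRingHom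

theorem ScalarExtension.smul_def (b : T ⊗[R] A) (x : ScalarExtension R A S T V) :
    b • x = baseChangeAction A S T V b x := rfl

instance [Module.Finite R A] [Module.Finite (S ⊗[R] A) V] :
    Module.Finite (T ⊗[R] A) (ScalarExtension R A S T V) := by
  have h1 : Module.Finite S V := Module.Finite.trans (S ⊗[R] A) V
  let _ : Module T (ScalarExtension R A S T V) := inferInstanceAs (Module T (T ⊗[S] V))
  have h2 : Module.Finite T (ScalarExtension R A S T V) :=
    inferInstanceAs (Module.Finite T (T ⊗[S] V))
  have h3 : IsScalarTower T (T ⊗[R] A) (ScalarExtension R A S T V) := ⟨fun t b x => by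
    simp only [ScalarExtension.smul_def, map_smul]
    rfl⟩
  exact Module.Finite.of_restrictScalars_finite T (T ⊗[R] A) _

variable {V} {W : Type w} [AddCommGroup W] [Module S W] [Module (S ⊗[R] A) W]
  [IsScalarTower S (S ⊗[R] A) W]

/-- The scalar extension of an `A^S`-linear map. -/
def ScalarExtension.map (f : V →ₗ[S ⊗[R] A] W) :
    ScalarExtension R A S T V →ₗ[T ⊗[R] A] ScalarExtension R A S T W where
  toFun := (f.restrictScalars S).lTensor T
  map_add' := map_add ((f.restrictScalars S).lTensor T)
  map_smul' b x := baseChangeAction_lTensor A S T f b x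

section Bundled

/-- A finitely generated module over `A^S = S ⊗ A`, regarded as an `S`-module via the canonical
map `S → A^S`. -/
local instance moduleOver (V : FGModuleCat.{w} (S ⊗[R] A)) : Module S V :=
  Module.compHom V (algebraMap S (S ⊗[R] A))

local instance moduleOver_isScalarTower (V : FGModuleCat.{w} (S ⊗[R] A)) :
    IsScalarTower S (S ⊗[R] A) V :=
  ⟨fun s x y => by
    change (s • x) • y = algebraMap S (S ⊗[R] A) s • x • y
    rw [Algebra.smul_def, mul_smul]⟩

/-- The scalar extension `V^T` of a finitely generated `A^S`-module `V`, as a finitely generated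
`A^T`-module. -/
def scalarExtension [Module.Finite R A] (V : FGModuleCat.{max u v} (S ⊗[R] A)) :
    FGModuleCat.{max u v} (T ⊗[R] A) :=
  FGModuleCat.of (T ⊗[R] A) (ScalarExtension R A S T V)

/-- For a field extension `k ⊆ l`, the homomorphism `G₀(A^k) → G₀(A^l)` with `[V] ↦ [V^l]`. -/
def G0.scalarExtension [Module.Finite R A] (k l : Type u) [Field k] [Field l] [Algebra R k]
    [Algebra R l] [Algebra k l] [IsScalarTower R k l] :
    G0.{max u v, max u v} (k ⊗[R] A) →+ G0.{max u v, max u v} (l ⊗[R] A) :=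
  G0.lift (fun V => G0.cls (DecompositionMaps.scalarExtension A k l V)) <|
    fun _ _ _ f g hf hfg hg => G0.cls_eq_add _ _ _
      (ScalarExtension.map A k l f) (ScalarExtension.map A k l g)
      (Module.Flat.lTensor_preserves_injective_linearMap (f.restrictScalars k) hf)
      (lTensor_exact l (f := f.restrictScalars k) (g := g.restrictScalars k) hfg hg)
      (LinearMap.lTensor_surjective l (g := g.restrictScalars k) hg)

/-- The `S`-module underlying the `A^S`-module `V` is free. -/
def IsFreeOver (V : FGModuleCat.{max u v} (S ⊗[R] A)) : Prop :=
  Module.Free S V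

end Bundled

end BaseChange

section Gates

variable (R : Type u) [CommRing R] (K : Type u) [Field K] [Algebra R K]

/-- A local ring `𝒪` between `R` and `K` whose maximal ideal `𝔪` satisfies `R ∩ 𝔪 = 𝔭`. -/
structure LocalRingAt (p : PrimeSpectrum R) where
  /-- The ring `𝒪`. -/
  ring : Subalgebra R K
  isLocalRing : IsLocalRing ring
  comap_maximalIdeal :
    (IsLocalRing.maximalIdeal ring).comap (algebraMap R ring) = p.asIdeal

attribute [instance] LocalRingAt.isLocalRing

variable {R K} {p : PrimeSpectrum R} (O : LocalRingAt R K p)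

/-- The residue field `k(𝔪)` of `𝒪`. -/
abbrev LocalRingAt.residueField : Type u :=
  (IsLocalRing.maximalIdeal O.ring).ResidueField

/-- The embedding `k(𝔭) → k(𝔪)`. -/
instance : Algebra p.asIdeal.ResidueField O.residueField :=
  (Ideal.ResidueField.map p.asIdeal (IsLocalRing.maximalIdeal O.ring) (algebraMap R O.ring)
    O.comap_maximalIdeal.symm).toAlgebra

instance : IsScalarTower R p.asIdeal.ResidueField O.residueField :=
  IsScalarTower.of_algebraMap_eq fun r => by
    rw [RingHom.algebraMap_toAlgebra, Ideal.ResidueField.map_algebraMap,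
      ← IsScalarTower.algebraMap_apply]

variable (A : Type v) [Ring A] [Algebra R A] [Module.Finite R A]

/-- `W` is an `𝒪`-free `A^𝒪`-form of the `A^K`-module `V`. -/
def IsFreeForm (V : FGModuleCat.{max u v} (K ⊗[R] A))
    (W : FGModuleCat.{max u v} (O.ring ⊗[R] A)) : Prop :=
  IsFreeOver A O.ring W ∧
    Nonempty (scalarExtension A O.ring K W ≃ₗ[K ⊗[R] A] V)

/-- The class `[W / 𝔪 W] = [k(𝔪) ⊗ W]` in `G₀(A^𝒪(𝔪))`, where the fibre `A^𝒪(𝔪)` is identified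
with `k(𝔪) ⊗ A`. -/
def reductionClass (W : FGModuleCat.{max u v} (O.ring ⊗[R] A)) :
    G0.{max u v, max u v} (O.residueField ⊗[R] A) :=
  G0.cls (scalarExtension A O.ring O.residueField W)

/-- The morphism `γ : G₀(A(𝔭)) → G₀(A^𝒪(𝔪))` given by scalar extension along `k(𝔭) → k(𝔪)`. -/
def residueExtension : G0.{max u v, max u v} (p.asIdeal.ResidueField ⊗[R] A) →+
    G0.{max u v, max u v} (O.residueField ⊗[R] A) :=
  G0.scalarExtension A p.asIdeal.ResidueField O.residueField

/-- `𝒪` is a weak `A`-gate in `𝔭`: every finite-dimensional `A^K`-module has an `𝒪`-free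
`A^𝒪`-form. -/
def IsWeakGate : Prop :=
  ∀ V : FGModuleCat.{max u v} (K ⊗[R] A), ∃ W, IsFreeForm O A V W

/-- `𝒪` is an `A`-gate in `𝔭`: it is a weak `A`-gate, and the reductions modulo `𝔪` of all
finitely generated `𝒪`-free `A^𝒪`-modules lie in the image of `G₀(A(𝔭))` in `G₀(A^𝒪(𝔪))`. -/
def IsGate : Prop :=
  IsWeakGate O A ∧ ∀ W : FGModuleCat.{max u v} (O.ring ⊗[R] A), IsFreeOver A O.ring W →
    reductionClass O A W ∈ (residueExtension O A).range

/-- `d` is the decomposition map of `A` in `𝔭` with respect to `𝒪`: for all finite-dimensional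
`A^K`-modules `V` and all `𝒪`-free `A^𝒪`-forms `W` of `V`, the image of `d [V]` in `G₀(A^𝒪(𝔪))`
is `[W / 𝔪 W]`. -/
def IsDecompositionMap (d : G0.{max u v, max u v} (K ⊗[R] A) →+
    G0.{max u v, max u v} (p.asIdeal.ResidueField ⊗[R] A)) : Prop :=
  ∀ (V : FGModuleCat.{max u v} (K ⊗[R] A)) (W : FGModuleCat.{max u v} (O.ring ⊗[R] A)),
    IsFreeForm O A V W → residueExtension O A (d (G0.cls V)) = reductionClass O A W

/-- A morphism of Grothendieck groups is trivial if it induces a bijection between the (classes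
of) simple modules. -/
def IsTrivialMap {B C : Type w} [Ring B] [Ring C]
    (d : G0.{w, w'} B →+ G0.{w, w'} C) : Prop :=
  Set.BijOn d (simpleClasses B) (simpleClasses C)

variable (R K)

/-- The set `DecGen(A)` of all primes `𝔭` of `R` in which there is an `A`-gate and such that for
every `A`-gate `𝒪` in `𝔭` the decomposition map exists, is unique, and is trivial. -/
def DecGen : Set (PrimeSpectrum R) :=
  {p | (∃ O : LocalRingAt R K p, IsGate O A) ∧
    ∀ O : LocalRingAt R K p, IsGate O A →
      (∃! d, IsDecompositionMap O A d) ∧ ∀ d, IsDecompositionMap O A d → IsTrivialMap d}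

end Gates

end

end DecompositionMaps

/-! Everything is controlled by one nonzero `f : R`, and the open set is the locus where `f` does
not vanish. The splitting map from `K ⊗ A` onto a product of matrix algebras has nilpotent kernel,
so in each factor a diagonal matrix unit lifts to an idempotent. Clearing denominators gives
elements `a i` of `A` itself with `a i * a i = f • a i`, and puts the matrix entries of the
splitting representation of `A` in `R[1/f]`. That representation can therefore be specialized to
every field `k` over `R` in which `f` is nonzero. It stays surjective with nil kernel
(`exists_matrixQuotient`), so the simple modules of all the algebras `k ⊗ A` are indexed by the same
finite set.

Over such a `k` the element `f⁻¹ a i` is a primitive idempotent, and the multiplicity of the `i`-th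
simple module in `V` is the dimension of `a i V`. These numbers give an isomorphism of `G₀(k ⊗ A)`
with `ℤ^ι` that carries simple classes to unit vectors (`multiplicity_bijective`,
`image_simpleClasses`). If `𝔭` does not contain `f`, then `f` is a unit in `𝒪`, and for an `𝒪`-free
`W` the image `a i W` is a direct summand whose rank survives every base change
(`cornerRank_scalarExtension`).

Hence extension from `k(𝔭)` to `k(𝔪)` and passage from `K ⊗ W` to `W/𝔪W` both preserve the
multiplicity vector. In these coordinates `γ` and the decomposition map are the identity. A gate
exists because any valuation ring dominating the localization at `𝔭` provides free lattices, and the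
second gate condition holds since `γ` is bijective. -/

namespace DecompositionMaps

noncomputable section

/-! ### Ranks of images of quasi-idempotents -/

section CornerRank

variable (S : Type*) [CommRing S] {B : Type*} [Ring B] [Algebra S B]

/-- The rank over `S` of the image `b V` of the action of `b ∈ B` on a `B`-module `V`. -/
def cornerRank (b : B) (V : Type*) [AddCommGroup V] [Module B V] : ℕ :=
  letI : Module S V := Module.compHom V (algebraMap S B)
  haveI : IsScalarTower S B V := .of_algebraMap_smul fun _ _ => rfl
  Module.finrank S (LinearMap.range (Algebra.lsmul S S V b))

/-- An `S`-structure compatible with the `B`-action is unique, so the one built into the definition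
agrees with any ambient one. -/
theorem cornerRank_eq (b : B) (V : Type*) [AddCommGroup V] [Module B V] [inst : Module S V]
    [IsScalarTower S B V] :
    cornerRank S b V = Module.finrank S (LinearMap.range (Algebra.lsmul S S V b)) := by
  obtain rfl : inst = Module.compHom V (algebraMap S B) :=
    Module.ext' _ _ fun s v => (algebraMap_smul B s v).symm
  rfl

theorem cornerRank_congr (b : B) {V W : Type*} [AddCommGroup V] [Module B V] [AddCommGroup W]
    [Module B W] (f : V ≃ₗ[B] W) : cornerRank S b V = cornerRank S b W := by
  let _ : Module S V := Module.compHom V (algebraMap S B)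
  have : IsScalarTower S B V := .of_algebraMap_smul fun _ _ => rfl
  let _ : Module S W := Module.compHom W (algebraMap S B)
  have : IsScalarTower S B W := .of_algebraMap_smul fun _ _ => rfl
  rw [cornerRank_eq, cornerRank_eq]
  have h : LinearMap.range (Algebra.lsmul S S W b) =
      (LinearMap.range (Algebra.lsmul S S V b)).map (f.restrictScalars S).toLinearMap := by
    ext w
    constructor
    · rintro ⟨y, rfl⟩
      exact ⟨b • f.symm y, ⟨f.symm y, rfl⟩, by simp⟩
    · rintro ⟨_, ⟨x, rfl⟩, rfl⟩
      exact ⟨f x, by simp⟩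
  rw [h]
  exact (LinearEquiv.finrank_map_eq (f.restrictScalars S) _).symm

/-- Since `c⁻¹ b` is idempotent, `V ↦ b V` is an exact functor to vector spaces, and dimension is
additive. -/
theorem cornerRank_eq_add {k : Type*} [Field k] [Algebra k B] [Module.Finite k B] {c : k}
    (hc : c ≠ 0) {b : B} (hb : b * b = c • b) {X Y Z : Type*} [AddCommGroup X] [Module B X]
    [AddCommGroup Y] [Module B Y] [Module.Finite B Y] [AddCommGroup Z] [Module B Z]
    (f : X →ₗ[B] Y) (g : Y →ₗ[B] Z) (hf : Function.Injective f) (hfg : Function.Exact f g)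
    (hg : Function.Surjective g) :
    cornerRank k b Y = cornerRank k b X + cornerRank k b Z := by
  let _ : Module k X := Module.compHom X (algebraMap k B)
  have : IsScalarTower k B X := .of_algebraMap_smul fun _ _ => rfl
  let _ : Module k Y := Module.compHom Y (algebraMap k B)
  have : IsScalarTower k B Y := .of_algebraMap_smul fun _ _ => rfl
  let _ : Module k Z := Module.compHom Z (algebraMap k B)
  have : IsScalarTower k B Z := .of_algebraMap_smul fun _ _ => rfl
  have : Module.Finite k Y := .trans B Y
  rw [cornerRank_eq, cornerRank_eq, cornerRank_eq]
  set P := LinearMap.range (Algebra.lsmul k k Y b)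
  have h := LinearMap.finrank_range_add_finrank_ker ((g.restrictScalars k).domRestrict P)
  have hrange : LinearMap.range ((g.restrictScalars k).domRestrict P) =
      LinearMap.range (Algebra.lsmul k k Z b) := by
    ext z
    constructor
    · rintro ⟨⟨_, y, rfl⟩, rfl⟩
      exact ⟨g y, by simp⟩
    · rintro ⟨z, rfl⟩
      obtain ⟨y, rfl⟩ := hg z
      exact ⟨⟨b • y, y, rfl⟩, by simp⟩
  have hker : (LinearMap.ker ((g.restrictScalars k).domRestrict P)).map P.subtype =
      (LinearMap.range (Algebra.lsmul k k X b)).map (f.restrictScalars k) := by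
    ext y
    constructor
    · rintro ⟨⟨_, y, rfl⟩, hy, rfl⟩
      have hy' : g (b • y) = 0 := hy
      obtain ⟨x, hx⟩ := (hfg _).mp hy'
      -- As `f x = b y`, applying `c⁻¹ b` to it gives `c⁻¹ b² y = b y` again.
      refine ⟨b • (c⁻¹ • x), ⟨_, rfl⟩, ?_⟩
      have h1 : f (b • c⁻¹ • x) = c⁻¹ • b • f x := by
        rw [map_smul, LinearMap.map_smul_of_tower, smul_comm]
      change f (b • c⁻¹ • x) = b • y
      rw [h1, hx, ← mul_smul, hb, smul_assoc, inv_smul_smul₀ hc]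
    · rintro ⟨_, ⟨x, rfl⟩, rfl⟩
      refine ⟨⟨b • f x, f x, rfl⟩, ?_, by simp⟩
      change g (b • f x) = 0
      rw [map_smul, hfg.apply_apply_eq_zero, smul_zero]
  have e₁ := (Submodule.equivMapOfInjective P.subtype P.subtype_injective
    (LinearMap.ker ((g.restrictScalars k).domRestrict P))).finrank_eq
  have e₂ := (Submodule.equivMapOfInjective (f.restrictScalars k) hf
    (LinearMap.range (Algebra.lsmul k k X b))).finrank_eq
  rw [hrange, e₁, hker, ← e₂] at h
  rw [← h, add_comm]

end CornerRank

/-- The matrix unit at `(a, b)` in the factor `i` of a product of matrix rings. -/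
abbrev matrixUnit (k : Type*) [Zero k] [One k] {ι : Type*} [DecidableEq ι] {m : ι → Type*}
    [∀ i, DecidableEq (m i)] (i : ι) (a b : m i) : ∀ i, Matrix (m i) (m i) k :=
  Pi.single i (Matrix.single a b 1)

/-- A surjection with nil kernel from a `k`-algebra `B` onto a product of full matrix algebras
over `k`, together with elements `e i` of `B` with `e i ^ 2 = c • e i` that are mapped to `c` times
the diagonal matrix unit at `z i` in the factor `i`. -/
structure MatrixQuotient {k B ι : Type*} [Field k] [Ring B] [Algebra k B] [DecidableEq ι]
    {m : ι → Type*} [∀ i, Fintype (m i)] [∀ i, DecidableEq (m i)] (z : ∀ i, m i) (c : k)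
    (e : ι → B) where
  /-- The surjection. -/
  hom : B →ₐ[k] ∀ i, Matrix (m i) (m i) k
  surjective : Function.Surjective hom
  isNilpotent : ∀ b, hom b = 0 → IsNilpotent b
  ne_zero : c ≠ 0
  mul_self : ∀ i, e i * e i = c • e i
  hom_apply : ∀ i, hom (e i) = c • matrixUnit k i (z i) (z i)

/-! ### Simple modules over an algebra with a matrix quotient -/

namespace MatrixQuotient

section Simple

variable {k B ι : Type*} [Field k] [Ring B] [Algebra k B] [DecidableEq ι]
  {m : ι → Type*} [∀ i, Fintype (m i)] [∀ i, DecidableEq (m i)] {z : ∀ i, m i} {c : k}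
  {e : ι → B} (D : MatrixQuotient z c e)

include D

/-- If `b s ≠ 0`, simplicity gives `x` with `x b s = s`; but `x b` lies in the kernel and is
nilpotent. -/
theorem smul_eq_zero_of_hom_eq_zero {S : Type*} [AddCommGroup S] [Module B S] [IsSimpleModule B S]
    {b : B} (hb : D.hom b = 0) (s : S) : b • s = 0 := by
  by_contra hs
  obtain ⟨x, hx⟩ := IsSimpleModule.toSpanSingleton_surjective B hs s
  obtain ⟨N, hN⟩ := D.isNilpotent (x * b) (by rw [map_mul, hb, mul_zero])
  have hx' : (x * b) • s = s := by rw [mul_smul]; exact hx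
  have h : ∀ N : ℕ, (x * b) ^ N • s = s := fun N => by
    induction N with
    | zero => simp
    | succ N ih => rw [pow_succ, mul_smul, hx', ih]
  refine hs ?_
  rw [← h N, hN, zero_smul, smul_zero]

theorem smul_congr {S : Type*} [AddCommGroup S] [Module B S] [IsSimpleModule B S]
    {b b' : B} (hb : D.hom b = D.hom b') (s : S) : b • s = b' • s := by
  rw [← sub_eq_zero, ← sub_smul]
  exact D.smul_eq_zero_of_hom_eq_zero (by rw [map_sub, hb, sub_self]) s

theorem exists_smul_ne_zero [Fintype ι] (S : Type*) [AddCommGroup S] [Module B S]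
    [IsSimpleModule B S] : ∃ i, ∃ s : S, e i • s ≠ 0 := by
  by_contra! h
  choose E hE using fun i (x : m i × m i) =>
    D.surjective (matrixUnit k i x.1 x.2)
  have := IsSimpleModule.nontrivial B S
  obtain ⟨s, hs⟩ := exists_ne (0 : S)
  -- The two-sided ideal generated by the `e i` contains, modulo the kernel, the unit `c`: move each
  -- corner along the diagonal and add up. If every `e i` killed the simple module, so would `c`.
  have h1 : D.hom (∑ i, ∑ a, E i (a, z i) * e i * E i (z i, a)) = D.hom (algebraMap k B c) := by
    simp only [map_sum, map_mul, hE, D.hom_apply, AlgHom.commutes]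
    have : ∀ i, ∀ a : m i, matrixUnit k i a (z i) * c • matrixUnit k i (z i) (z i) *
        matrixUnit k i (z i) a = c • matrixUnit k i a a := fun i a => by
      rw [mul_smul_comm, smul_mul_assoc, ← Pi.single_mul, ← Pi.single_mul]
      simp
    simp only [this, ← Finset.smul_sum, Algebra.algebraMap_eq_smul_one]
    congr 1
    funext j
    ext a b
    rw [Finset.sum_apply, Finset.sum_eq_single j]
    · rw [Finset.sum_apply]
      simp only [matrixUnit, Pi.single_eq_same, Matrix.sum_apply, Matrix.single_apply,
        Pi.one_apply, Matrix.one_apply]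
      rw [Finset.sum_eq_single a (fun d _ hd => if_neg fun h => hd h.1) (by simp)]
      simp
    · intro i _ hij
      rw [Finset.sum_apply]
      exact Finset.sum_eq_zero fun a _ => Pi.single_eq_of_ne hij.symm _
    · simp
  have h2 := D.smul_congr h1 s
  simp only [Finset.sum_smul, mul_smul, h, smul_zero, Finset.sum_const_zero] at h2
  refine hs ?_
  have h3 : (algebraMap k B c⁻¹ * algebraMap k B c) • s = 0 := by rw [mul_smul, ← h2, smul_zero]
  rwa [← map_mul, inv_mul_cancel₀ D.ne_zero, map_one, one_smul] at h3

/-- Modulo the kernel, the corner `e i B e i` consists of scalar multiples of a single matrix unit.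
-/
theorem smul_smul_smul {S : Type*} [AddCommGroup S] [Module B S] [IsSimpleModule B S]
    (i : ι) (b : B) (s : S) :
    e i • b • e i • s = algebraMap k B (c * D.hom b i (z i) (z i)) • e i • s := by
  rw [← mul_smul, ← mul_smul, ← mul_smul]
  refine D.smul_congr ?_ s
  simp only [map_mul, D.hom_apply, AlgHom.commutes]
  funext j
  by_cases hj : j = i
  · subst hj
    ext p q
    simp [Matrix.single_mul_mul_single, Algebra.algebraMap_eq_smul_one, Matrix.single_apply]
    ring_nf
  · simp [Pi.single_eq_of_ne hj]

theorem smul_smul_smul_of_ne {S : Type*} [AddCommGroup S] [Module B S] [IsSimpleModule B S]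
    {i j : ι} (hij : j ≠ i) (b : B) (s : S) : e j • b • e i • s = 0 := by
  rw [← mul_smul, ← mul_smul]
  refine D.smul_eq_zero_of_hom_eq_zero ?_ s
  simp only [map_mul, D.hom_apply]
  funext l
  by_cases hl : l = i
  · subst hl
    simp [Pi.single_eq_of_ne hij.symm]
  · simp [Pi.single_eq_of_ne hl]

theorem cornerRank_eq_one {S : Type*} [AddCommGroup S] [Module B S] [IsSimpleModule B S] {i : ι}
    {s : S} (hs : e i • s ≠ 0) : cornerRank k (e i) S = 1 := by
  let _ : Module k S := Module.compHom S (algebraMap k B)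
  have : IsScalarTower k B S := .of_algebraMap_smul fun _ _ => rfl
  rw [cornerRank_eq]
  have h : LinearMap.range (Algebra.lsmul k k S (e i)) = Submodule.span k {e i • s} := by
    refine le_antisymm ?_ ?_
    · rintro _ ⟨x, rfl⟩
      obtain ⟨b, rfl⟩ := IsSimpleModule.toSpanSingleton_surjective B hs x
      refine Submodule.mem_span_singleton.mpr ⟨c * D.hom b i (z i) (z i), ?_⟩
      exact (D.smul_smul_smul i b s).symm
    · rw [Submodule.span_singleton_le_iff_mem]
      exact ⟨s, rfl⟩
  rw [h, finrank_span_singleton hs]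

theorem cornerRank_eq_zero {S : Type*} [AddCommGroup S] [Module B S] [IsSimpleModule B S] {i j : ι}
    (hij : j ≠ i) {s : S} (hs : e i • s ≠ 0) : cornerRank k (e j) S = 0 := by
  let _ : Module k S := Module.compHom S (algebraMap k B)
  have : IsScalarTower k B S := .of_algebraMap_smul fun _ _ => rfl
  rw [cornerRank_eq]
  have h : LinearMap.range (Algebra.lsmul k k S (e j)) = ⊥ := by
    rw [eq_bot_iff]
    rintro _ ⟨x, rfl⟩
    obtain ⟨b, rfl⟩ := IsSimpleModule.toSpanSingleton_surjective B hs x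
    exact D.smul_smul_smul_of_ne hij b s
  rw [h, finrank_bot]

/-- The point is that the right-hand side involves neither `S` nor `s`: the annihilator of `e i • s`
depends on `i` alone, which makes simple modules with the same `i` isomorphic. -/
theorem smul_smul_eq_zero_iff {S : Type*} [AddCommGroup S] [Module B S] [IsSimpleModule B S]
    {i : ι} {s : S} (hs : e i • s ≠ 0) (b : B) :
    b • e i • s = 0 ↔ ∀ a, D.hom b i a (z i) = 0 := by
  constructor
  · intro h a
    obtain ⟨x, hx⟩ := D.surjective (Pi.single i (Matrix.single (z i) a (1 : k)))
    have h1 := D.smul_smul_smul i (x * b) s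
    have h3 : D.hom (x * b) i (z i) (z i) = D.hom b i a (z i) := by simp [hx]
    rw [mul_smul, h, smul_zero, smul_zero, h3] at h1
    by_contra h0
    have h2 : c * D.hom b i a (z i) ≠ 0 := mul_ne_zero D.ne_zero h0
    refine hs ?_
    rw [← one_smul B (e i • s), ← map_one (algebraMap k B), ← inv_mul_cancel₀ h2, map_mul, mul_smul]
    rw [← h1, smul_zero]
  · intro h
    rw [← mul_smul]
    refine D.smul_eq_zero_of_hom_eq_zero ?_ s
    rw [map_mul, D.hom_apply]
    funext l
    by_cases hl : l = i
    · subst hl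
      ext a b
      by_cases hb : b = z l
      · subst hb
        simp [h]
      · simp [Matrix.mul_single_apply_of_ne _ _ _ _ _ hb]
    · simp [Pi.single_eq_of_ne hl]

theorem nonempty_linearEquiv {S S' : Type*} [AddCommGroup S] [Module B S] [IsSimpleModule B S]
    [AddCommGroup S'] [Module B S'] [IsSimpleModule B S'] {i : ι} {s : S} {s' : S'}
    (hs : e i • s ≠ 0) (hs' : e i • s' ≠ 0) : Nonempty (S ≃ₗ[B] S') := by
  have h : LinearMap.ker (LinearMap.toSpanSingleton B S (e i • s)) =
      LinearMap.ker (LinearMap.toSpanSingleton B S' (e i • s')) := by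
    ext b
    simp only [LinearMap.mem_ker, LinearMap.toSpanSingleton_apply, D.smul_smul_eq_zero_iff hs,
      D.smul_smul_eq_zero_iff hs']
  exact ⟨(LinearMap.quotKerEquivOfSurjective _
    (IsSimpleModule.toSpanSingleton_surjective B hs)).symm.trans
    ((Submodule.quotEquivOfEq _ _ h).trans (LinearMap.quotKerEquivOfSurjective _
    (IsSimpleModule.toSpanSingleton_surjective B hs')))⟩

/-- Take a maximal left ideal above the left annihilator of `e i`. It contains `e i - c`, so
containing `e i` would force it to contain the unit `c`. -/
theorem exists_isMaximal (i : ι) : ∃ M : Ideal B, M.IsMaximal ∧ e i ∉ M := by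
  have hI : LinearMap.ker (LinearMap.toSpanSingleton B B (e i)) ≠ ⊤ := by
    rw [Ne, LinearMap.ker_eq_top]
    intro h
    have h1 : e i = 0 := by simpa using LinearMap.congr_fun h 1
    have h2 := congr_fun (congr_fun (congr_fun (D.hom_apply i) i) (z i)) (z i)
    rw [h1, map_zero] at h2
    simp [D.ne_zero.symm] at h2
  obtain ⟨M, hM, hle⟩ := Ideal.exists_le_maximal _ hI
  refine ⟨M, hM, fun he => hM.ne_top ?_⟩
  have h1 : e i - algebraMap k B c ∈ M := hle (by
    simp [sub_mul, D.mul_self, Algebra.smul_def])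
  have h2 : algebraMap k B c ∈ M := by simpa using M.sub_mem he h1
  have h3 := M.mul_mem_left (algebraMap k B c⁻¹) h2
  rwa [← map_mul, inv_mul_cancel₀ D.ne_zero, map_one, ← Ideal.eq_top_iff_one] at h3

end Simple
end MatrixQuotient

/-! ### Generation of `G₀` by simple classes -/

section Grothendieck

variable {B : Type w} [Ring B]

theorem G0.cls_congr {V W : FGModuleCat.{w'} B} (f : V ≃ₗ[B] W) : G0.cls V = G0.cls W := by
  have h1 : G0.cls (FGModuleCat.of B PUnit.{w' + 1}) = (0 : G0.{w, w'} B) := by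
    simpa using G0.cls_eq_add (FGModuleCat.of B PUnit.{w' + 1}) (FGModuleCat.of B PUnit.{w' + 1})
      (FGModuleCat.of B PUnit.{w' + 1}) LinearMap.id LinearMap.id Function.injective_id
      (fun _ => by simp) Function.surjective_id
  have h2 := G0.cls_eq_add V W (FGModuleCat.of B PUnit.{w' + 1}) f.toLinearMap 0 f.injective
    (fun x => by simp) (fun x => ⟨0, rfl⟩)
  rw [h2, h1, add_zero]

theorem closure_simpleClasses [IsArtinianRing B] :
    AddSubgroup.closure (simpleClasses.{w, w'} B) = ⊤ := by
  have key : ∀ (M : Type w') [AddCommGroup M] [Module B M], IsFiniteLength B M →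
      ∀ h : Module.Finite B M,
        G0.cls (FGModuleCat.of B M) ∈ AddSubgroup.closure (simpleClasses.{w, w'} B) := by
    intro M _ _ hM
    induction hM with
    | of_subsingleton =>
      rename_i M _ _ _
      intro _
      have := G0.cls_eq_add (FGModuleCat.of B M) (FGModuleCat.of B M) (FGModuleCat.of B M)
        LinearMap.id LinearMap.id Function.injective_id
        (fun x => by simpa using Subsingleton.elim 0 x) Function.surjective_id
      rw [left_eq_add] at this
      rw [this]
      exact zero_mem _
    | of_simple_quotient hN ih =>
      rename_i M _ _ N _
      intro _
      have : Module.Finite B N := inferInstance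
      rw [G0.cls_eq_add (FGModuleCat.of B N) (FGModuleCat.of B M) (FGModuleCat.of B (M ⧸ N))
        N.subtype N.mkQ N.subtype_injective (LinearMap.exact_subtype_mkQ N) N.mkQ_surjective]
      exact add_mem (ih this) (AddSubgroup.subset_closure ⟨_, ‹_›, rfl⟩)
  rw [eq_top_iff]
  rintro x -
  obtain ⟨x, rfl⟩ := QuotientAddGroup.mk_surjective x
  induction x using FreeAbelianGroup.induction_on with
  | zero => exact zero_mem _
  | of V =>
    exact key V (isFiniteLength_iff_isNoetherian_isArtinian.mpr ⟨inferInstance, inferInstance⟩)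
      inferInstance
  | neg x hx => exact neg_mem hx
  | add x y hx hy => exact add_mem hx hy

theorem G0.addHom_ext {H : Type*} [AddCommGroup H] {f g : G0.{w, w'} B →+ H}
    (h : ∀ V, f (G0.cls V) = g (G0.cls V)) : f = g := by
  ext x
  obtain ⟨x, rfl⟩ := QuotientAddGroup.mk_surjective x
  induction x using FreeAbelianGroup.induction_on with
  | zero => exact (map_zero f).trans (map_zero g).symm
  | of V => exact h V
  | neg x hx =>
    exact (map_neg f _).trans ((congrArg _ hx).trans (map_neg g _).symm)
  | add x y hx hy =>
    exact (map_add f _ _).trans ((congrArg₂ _ hx hy).trans (map_add g _ _).symm)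

end Grothendieck

/-! ### Multiplicity coordinates on `G₀` -/

namespace MatrixQuotient

variable {k ι : Type*} {B : Type w} [Field k] [Ring B] [Algebra k B] [Module.Finite k B]
  [DecidableEq ι] {m : ι → Type*} [∀ i, Fintype (m i)] [∀ i, DecidableEq (m i)] {z : ∀ i, m i}
  {c : k} {e : ι → B} (D : MatrixQuotient z c e)

/-- The homomorphism `G₀(B) → ℤ^ι` that maps the class of `V` to the multiplicities of the simple
`B`-modules in `V`. -/
def multiplicity : G0.{w, w'} B →+ (ι → ℤ) :=
  G0.lift (fun V i => (cornerRank k (e i) V : ℤ)) fun X Y Z f g hf hfg hg => by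
    funext i
    simp [cornerRank_eq_add D.ne_zero (D.mul_self i) f g hf hfg hg]

theorem multiplicity_cls (V : FGModuleCat.{w'} B) :
    D.multiplicity (G0.cls V) = fun i => (cornerRank k (e i) V : ℤ) :=
  G0.lift_cls _ _ V

theorem exists_isSimpleModule (i : ι) : ∃ V : FGModuleCat.{w} B, IsSimpleModule B V ∧
    D.multiplicity (G0.cls V) = Pi.single i 1 := by
  obtain ⟨M, hM, he⟩ := D.exists_isMaximal i
  have hs : e i • (Submodule.Quotient.mk 1 : B ⧸ M) ≠ 0 := by
    rw [← Submodule.Quotient.mk_smul, Ne, Submodule.Quotient.mk_eq_zero]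
    simpa using he
  have : IsSimpleModule B (B ⧸ M) := isSimpleModule_iff_isCoatom.mpr hM.out
  refine ⟨FGModuleCat.of B (B ⧸ M), this, ?_⟩
  rw [multiplicity_cls]
  funext j
  rcases eq_or_ne j i with rfl | hj
  · simp [D.cornerRank_eq_one hs]
  · simp [D.cornerRank_eq_zero hj hs, hj]

variable [Fintype ι]

theorem multiplicity_cls_of_isSimpleModule (V : FGModuleCat.{w'} B) [IsSimpleModule B V] :
    ∃ i, (∃ s : V, e i • s ≠ 0) ∧ D.multiplicity (G0.cls V) = Pi.single i 1 := by
  obtain ⟨i, s, hs⟩ := D.exists_smul_ne_zero V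
  refine ⟨i, ⟨s, hs⟩, ?_⟩
  rw [multiplicity_cls]
  funext j
  rcases eq_or_ne j i with rfl | hj
  · simp [D.cornerRank_eq_one hs]
  · simp [D.cornerRank_eq_zero hj hs, hj]

/-- The inverse `σ` sends the `i`-th unit vector to the class of a chosen `i`-th simple module. That
it is a left inverse is checked on simple classes, which generate, using that simple modules with
the same index are isomorphic. -/
theorem multiplicity_bijective : Function.Bijective (D.multiplicity : G0.{w, w} B →+ _) := by
  choose V hV hmul using D.exists_isSimpleModule
  let σ : (ι → ℤ) →+ G0.{w, w} B :=
    { toFun := fun x => ∑ i, x i • G0.cls (V i)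
      map_zero' := by simp
      map_add' := fun x y => by simp [add_smul, Finset.sum_add_distrib] }
  have hσ : ∀ i, σ (Pi.single i 1) = G0.cls (V i) := fun i => by
    change ∑ j, (Pi.single i 1 : ι → ℤ) j • G0.cls (V j) = _
    rw [Finset.sum_eq_single i (fun j _ hj => by simp [hj]) (by simp)]
    simp
  have : IsArtinianRing B := .of_finite k B
  have h1 : σ.comp D.multiplicity = AddMonoidHom.id _ := by
    refine AddMonoidHom.eq_of_eqOn_dense (closure_simpleClasses (B := B)) ?_
    rintro _ ⟨S, hS, rfl⟩
    obtain ⟨i, ⟨s, hs⟩, hi⟩ := D.multiplicity_cls_of_isSimpleModule S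
    have := hV i
    obtain ⟨j, ⟨t, ht⟩, hj⟩ := D.multiplicity_cls_of_isSimpleModule (V i)
    rw [hmul i] at hj
    obtain rfl : i = j := by
      by_contra h
      simpa [h] using congr_fun hj i
    obtain ⟨f⟩ := D.nonempty_linearEquiv ht hs
    simpa [hi, hσ] using G0.cls_congr f
  have h2 : ∀ x, D.multiplicity (σ x) = x := fun x => by
    change D.multiplicity (∑ i, x i • G0.cls (V i)) = x
    simp only [map_sum, map_zsmul, hmul]
    funext j
    rw [Finset.sum_apply, Finset.sum_eq_single j (fun i _ hi => by simp [hi.symm]) (by simp)]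
    simp
  exact ⟨Function.LeftInverse.injective (g := σ) fun x => DFunLike.congr_fun h1 x,
    fun x => ⟨_, h2 x⟩⟩

theorem image_simpleClasses : (D.multiplicity : G0.{w, w} B →+ _) '' simpleClasses B =
    Set.range fun i => (Pi.single i 1 : ι → ℤ) := by
  ext x
  constructor
  · rintro ⟨_, ⟨S, hS, rfl⟩, rfl⟩
    obtain ⟨i, -, hi⟩ := D.multiplicity_cls_of_isSimpleModule S
    exact ⟨i, hi.symm⟩
  · rintro ⟨i, rfl⟩
    obtain ⟨V, hV, hi⟩ := D.exists_isSimpleModule i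
    exact ⟨_, ⟨V, hV, rfl⟩, hi⟩

end MatrixQuotient

/-! ### Invariance of corner ranks under base change -/

/-- With `c` a unit, `c⁻¹ φ` is a projection onto the image of `φ`. The image is thus a direct
summand, free because `S` is local, and forming it commutes with base change. -/
theorem finrank_range_baseChange {S W : Type*} (T : Type*) [CommRing S] [IsLocalRing S] [CommRing T]
    [Nontrivial T] [Algebra S T] [AddCommGroup W] [Module S W] [Module.Finite S W] [Module.Free S W]
    {φ : W →ₗ[S] W} {c : S} (hc : IsUnit c) (hφ : ∀ x, φ (φ x) = c • φ x) :
    Module.finrank T (LinearMap.range (φ.baseChange T)) =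
      Module.finrank S (LinearMap.range φ) := by
  obtain ⟨c, rfl⟩ := hc
  set P := LinearMap.range φ
  let ρ : W →ₗ[S] P := ((c⁻¹ : Sˣ) : S) • φ.rangeRestrict
  have hρ : ρ ∘ₗ P.subtype = LinearMap.id := by
    ext ⟨_, x, rfl⟩
    simp [ρ, hφ, smul_smul]
  have : Module.Projective S P := .of_split P.subtype ρ hρ
  have : Module.Finite S P := inferInstanceAs (Module.Finite S (LinearMap.range φ))
  have : Module.Free S P := Module.free_of_flat_of_isLocalRing
  have hinj : Function.Injective (P.subtype.baseChange T) := by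
    refine Function.LeftInverse.injective (g := ρ.baseChange T) fun x => ?_
    rw [← LinearMap.comp_apply, ← LinearMap.baseChange_comp, hρ, LinearMap.baseChange_id,
      LinearMap.id_apply]
  have hsurj : Function.Surjective (φ.rangeRestrict.baseChange T) :=
    LinearMap.lTensor_surjective T φ.surjective_rangeRestrict
  have hrange : LinearMap.range (φ.baseChange T) = LinearMap.range (P.subtype.baseChange T) := by
    conv_lhs => rw [← LinearMap.subtype_comp_codRestrict (p := P) φ (LinearMap.mem_range_self φ),
      LinearMap.baseChange_comp]
    exact LinearMap.range_comp_of_range_eq_top _ (LinearMap.range_eq_top.mpr hsurj)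
  rw [hrange, LinearMap.finrank_range_of_inj hinj, Module.finrank_baseChange]

section

variable {R : Type u} [CommRing R] (A : Type v) [Ring A] [Algebra R A] [Module.Finite R A]
  (S T : Type u) [CommRing S] [Algebra R S] [CommRing T] [Algebra R T] [Algebra S T]
  [IsScalarTower R S T] [IsLocalRing S] [Nontrivial T]

attribute [local instance] moduleOver moduleOver_isScalarTower

/-- Used with `S = 𝒪` and `T` either `K` or the residue field, and also for extensions of fields. -/
theorem cornerRank_scalarExtension {V : FGModuleCat.{max u v} (S ⊗[R] A)} (hV : IsFreeOver A S V)
    {f : R} (hf : IsUnit (algebraMap R S f)) {a : A} (ha : a * a = f • a) :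
    cornerRank T ((1 : T) ⊗ₜ[R] a) (scalarExtension A S T V) =
      cornerRank S ((1 : S) ⊗ₜ[R] a) V := by
  have : Module.Free S V := hV
  have : Module.Finite S V := .trans (S ⊗[R] A) V
  have hφ : ∀ x : V, Algebra.lsmul S S V ((1 : S) ⊗ₜ[R] a) (Algebra.lsmul S S V ((1 : S) ⊗ₜ[R] a) x)
      = algebraMap R S f • Algebra.lsmul S S V ((1 : S) ⊗ₜ[R] a) x := fun x => by
    simp only [Algebra.lsmul_coe]
    rw [← mul_smul, ← smul_assoc, Algebra.TensorProduct.tmul_mul_tmul, ha, mul_one,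
      algebraMap_smul, TensorProduct.tmul_smul]
  have hact : baseChangeAction A S T V ((1 : T) ⊗ₜ[R] a) =
      (Algebra.lsmul S S V ((1 : S) ⊗ₜ[R] a)).baseChange T := by
    refine LinearMap.ext fun x => ?_
    induction x using TensorProduct.induction_on with
    | zero => simp
    | add x y hx hy => rw [map_add, hx, hy, map_add]
    | tmul t x =>
      rw [baseChangeAction_tmul]
      simp
  rw [cornerRank_eq S, ← finrank_range_baseChange T hf hφ]
  let _ : Module T (scalarExtension A S T V) := inferInstanceAs (Module T (T ⊗[S] V))
  have : IsScalarTower T (T ⊗[R] A) (scalarExtension A S T V) :=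
    .of_algebraMap_smul fun t x => by
      change baseChangeAction A S T V (algebraMap T (T ⊗[R] A) t) x = _
      rw [AlgHom.commutes]
      rfl
  rw [cornerRank_eq]
  have h : Algebra.lsmul T T (scalarExtension A S T V) ((1 : T) ⊗ₜ[R] a) =
      (Algebra.lsmul S S V ((1 : S) ⊗ₜ[R] a)).baseChange T :=
    LinearMap.ext fun x => LinearMap.congr_fun hact x
  rw [h]
  rfl

end

theorem eq_sum_matrixUnit {k ι : Type*} [CommRing k] [Fintype ι] [DecidableEq ι] {m : ι → Type*}
    [∀ i, Fintype (m i)] [∀ i, DecidableEq (m i)] (x : ∀ i, Matrix (m i) (m i) k) :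
    x = ∑ q : Σ i, m i × m i, x q.1 q.2.1 q.2.2 • matrixUnit k q.1 q.2.1 q.2.2 := by
  funext j
  ext a b
  rw [Finset.sum_apply, Matrix.sum_apply, Finset.sum_eq_single ⟨j, a, b⟩]
  · simp
  · rintro ⟨i, p, q⟩ - h
    rcases eq_or_ne j i with rfl | hj
    · rcases eq_or_ne p a with rfl | hp
      · rcases eq_or_ne q b with rfl | hq
        · exact absurd rfl h
        · simp [hq]
      · simp [hp]
    · simp [Pi.single_eq_of_ne hj]
  · simp

/-! ### Nilpotence of the kernel after specialization -/

section Nilpotent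

open scoped Pointwise

variable {R A k ι : Type*} [CommRing R] [Ring A] [Algebra R A] [Field k] [Algebra R k]
  [Fintype ι] [DecidableEq ι] {m : ι → Type*} [∀ i, Fintype (m i)] [∀ i, DecidableEq (m i)]

theorem isNilpotent_of_mem_span {s : Set A} {N : ℕ} (hN : s ^ N ⊆ {0}) {y : k ⊗[R] A}
    (hy : y ∈ Submodule.span k ((Algebra.TensorProduct.includeRight : A →ₐ[R] k ⊗[R] A) '' s)) :
    IsNilpotent y := by
  refine ⟨N, ?_⟩
  have h := Submodule.pow_mem_pow _ hy N
  rw [Submodule.span_pow, ← Set.image_pow] at h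
  simpa using Submodule.span_mono (R := k) (Set.image_mono
    (f := (Algebra.TensorProduct.includeRight : A →ₐ[R] k ⊗[R] A)) hN) h

/-- Because `f` is invertible in `k`, the images of `s` and of the `x q` span `k ⊗ A`. The map kills
`s` and sends the `x q` to independent elements, so its kernel lies in the span of `s`, where all
products of `N` elements vanish. -/
theorem isNilpotent_of_lift_eq_zero (φ : A →ₐ[R] ∀ i, Matrix (m i) (m i) k) {f : R}
    (hf : algebraMap R k f ≠ 0) {x : (Σ i, m i × m i) → A}
    (hx : ∀ q, φ (x q) = algebraMap R k f • matrixUnit k q.1 q.2.1 q.2.2) {s : Set A} {N : ℕ}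
    (hN : s ^ N ⊆ {0}) (hs : ∀ a ∈ s, φ a = 0) {G : Set A} (hG : Submodule.span R G = ⊤)
    (hGs : ∀ g ∈ G, ∃ j ∈ s, ∃ r : (Σ i, m i × m i) → R, (f * f) • g = j + ∑ q, r q • x q)
    {y : k ⊗[R] A} (hy : AlgHom.liftEquiv R k A _ φ y = 0) : IsNilpotent y := by
  set P := Submodule.span k ((Algebra.TensorProduct.includeRight : A →ₐ[R] k ⊗[R] A) '' s) with hP
  have key : ∀ y : k ⊗[R] A, ∃ p ∈ P, ∃ r : (Σ i, m i × m i) → k,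
      y = p + ∑ q, r q • ((1 : k) ⊗ₜ[R] x q) := by
    intro y
    induction y using TensorProduct.induction_on with
    | zero => exact ⟨0, zero_mem _, 0, by simp⟩
    | add y y' hy hy' =>
      obtain ⟨p, hp, r, rfl⟩ := hy
      obtain ⟨p', hp', r', rfl⟩ := hy'
      refine ⟨p + p', add_mem hp hp', r + r', ?_⟩
      simp only [Pi.add_apply, add_smul, Finset.sum_add_distrib]
      abel
    | tmul t a =>
      have ha : a ∈ Submodule.span R G := hG ▸ Submodule.mem_top
      induction ha using Submodule.span_induction generalizing t with
      | mem g hg =>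
        obtain ⟨j, hj, r, h⟩ := hGs g hg
        have hff : algebraMap R k (f * f) ≠ 0 := by
          rw [map_mul]; exact mul_ne_zero hf hf
        have h1 : t ⊗ₜ[R] g = ((algebraMap R k (f * f))⁻¹ * t) • ((1 : k) ⊗ₜ[R] ((f * f) • g)) := by
          rw [TensorProduct.tmul_smul, ← algebraMap_smul k (f * f), smul_smul, mul_right_comm,
            inv_mul_cancel₀ hff, one_mul, TensorProduct.smul_tmul', smul_eq_mul, mul_one]
        refine ⟨((algebraMap R k (f * f))⁻¹ * t) • ((1 : k) ⊗ₜ[R] j),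
          P.smul_mem _ (Submodule.subset_span ⟨j, hj, rfl⟩),
          fun q => ((algebraMap R k (f * f))⁻¹ * t) * algebraMap R k (r q), ?_⟩
        rw [h1, h, TensorProduct.tmul_add, smul_add, TensorProduct.tmul_sum, Finset.smul_sum]
        simp only [TensorProduct.tmul_smul, mul_smul, algebraMap_smul]
      | zero => exact ⟨0, zero_mem _, 0, by simp⟩
      | add a b _ _ ha hb =>
        obtain ⟨p, hp, r, h⟩ := ha t
        obtain ⟨p', hp', r', h'⟩ := hb t
        refine ⟨p + p', add_mem hp hp', r + r', ?_⟩
        simp only [TensorProduct.tmul_add, h, h', Pi.add_apply, add_smul, Finset.sum_add_distrib]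
        abel
      | smul c a _ ha =>
        obtain ⟨p, hp, r, h⟩ := ha (c • t)
        exact ⟨p, hp, r, by rw [← h, TensorProduct.smul_tmul]⟩
  obtain ⟨p, hp, r, rfl⟩ := key y
  have hp0 : AlgHom.liftEquiv R k A _ φ p = 0 := by
    have : P ≤ LinearMap.ker (AlgHom.liftEquiv R k A _ φ).toLinearMap := by
      rw [hP, Submodule.span_le]
      rintro _ ⟨a, ha, rfl⟩
      simp [hs a ha]
    exact this hp
  have hr : ∑ q, (r q * algebraMap R k f) • matrixUnit k q.1 q.2.1 q.2.2 = 0 := by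
    rw [map_add, hp0, zero_add, map_sum] at hy
    rw [← hy]
    refine Finset.sum_congr rfl fun q _ => ?_
    simp [hx, mul_smul]
  have hr0 : ∀ q, r q = 0 := fun q => by
    have h := eq_sum_matrixUnit (fun i => Matrix.of fun a b => r ⟨i, a, b⟩ * algebraMap R k f)
    have h0 := congr_fun (congr_fun (congr_fun (h.trans hr) q.1) q.2.1) q.2.2
    exact (mul_eq_zero.mp h0).resolve_right hf
  simpa [hr0] using isNilpotent_of_mem_span hN hp

end Nilpotent

/-! ### Specializing a matrix representation -/

section Specialization

/-- A representation over `K` with entries in a subalgebra `S`, specialized along `S → k`. -/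
def specialize {R K A k ι : Type*} [CommRing R] [CommRing K] [Algebra R K] [Ring A] [Algebra R A]
    [CommRing k] [Algebra R k] {m : ι → Type*} [∀ i, Fintype (m i)] [∀ i, DecidableEq (m i)]
    {S : Subalgebra R K} (ρ : S →ₐ[R] k) (π : A →ₐ[R] ∀ i, Matrix (m i) (m i) K)
    (h : ∀ a i p q, π a i p q ∈ S) : A →ₐ[R] ∀ i, Matrix (m i) (m i) k where
  toFun a i := Matrix.of fun p q => ρ ⟨π a i p q, h a i p q⟩
  map_one' := by
    funext i
    ext p q
    rw [Matrix.of_apply, Pi.one_apply, Matrix.one_apply]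
    split_ifs with hpq
    · rw [← map_one ρ]
      congr
      simp [hpq]
    · rw [← map_zero ρ]
      congr
      simp [hpq]
  map_zero' := by
    funext i
    ext p q
    rw [Matrix.of_apply, Pi.zero_apply, Matrix.zero_apply, ← map_zero ρ]
    congr
    simp
  map_mul' a b := by
    funext i
    ext p q
    have hab : (⟨π (a * b) i p q, h (a * b) i p q⟩ : S) =
        ∑ j, ⟨π a i p j, h a i p j⟩ * ⟨π b i j q, h b i j q⟩ :=
      Subtype.ext (by simp [Matrix.mul_apply])
    rw [Matrix.of_apply, hab, map_sum, Pi.mul_apply, Matrix.mul_apply]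
    exact Finset.sum_congr rfl fun j _ => map_mul ρ _ _
  map_add' a b := by
    funext i
    ext p q
    simp only [Matrix.of_apply, Pi.add_apply, Matrix.add_apply, ← map_add]
    congr
    simp
  commutes' r := by
    funext i
    ext p q
    simp only [Matrix.of_apply, Pi.algebraMap_apply, Matrix.algebraMap_matrix_apply]
    split_ifs with hpq
    · rw [← ρ.commutes]
      congr
      simp [Matrix.algebraMap_matrix_apply, hpq]
    · rw [← map_zero ρ]
      congr
      simp [Matrix.algebraMap_matrix_apply, hpq]

theorem specialize_apply {R K A k ι : Type*} [CommRing R] [CommRing K] [Algebra R K] [Ring A]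
    [Algebra R A] [CommRing k] [Algebra R k] {m : ι → Type*} [∀ i, Fintype (m i)]
    [∀ i, DecidableEq (m i)] {S : Subalgebra R K} (ρ : S →ₐ[R] k)
    (π : A →ₐ[R] ∀ i, Matrix (m i) (m i) K) (h : ∀ a i p q, π a i p q ∈ S) (a : A) (i : ι)
    (p q : m i) : specialize ρ π h a i p q = ρ ⟨π a i p q, h a i p q⟩ := rfl

theorem specialize_eq_zero {R K A k ι : Type*} [CommRing R] [CommRing K] [Algebra R K] [Ring A]
    [Algebra R A] [CommRing k] [Algebra R k] {m : ι → Type*} [∀ i, Fintype (m i)]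
    [∀ i, DecidableEq (m i)] {S : Subalgebra R K} (ρ : S →ₐ[R] k)
    (π : A →ₐ[R] ∀ i, Matrix (m i) (m i) K) (h : ∀ a i p q, π a i p q ∈ S) {a : A}
    (ha : π a = 0) : specialize ρ π h a = 0 := by
  funext i
  ext p q
  rw [specialize_apply, Pi.zero_apply, Matrix.zero_apply, ← map_zero ρ]
  congr
  simp [ha]

theorem specialize_eq_matrixUnit {R K A k ι : Type*} [CommRing R] [CommRing K] [Algebra R K]
    [Ring A] [Algebra R A] [CommRing k] [Algebra R k] [DecidableEq ι] {m : ι → Type*}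
    [∀ i, Fintype (m i)] [∀ i, DecidableEq (m i)] {S : Subalgebra R K} (ρ : S →ₐ[R] k)
    (π : A →ₐ[R] ∀ i, Matrix (m i) (m i) K) (h : ∀ a i p q, π a i p q ∈ S) {a : A} {f : R} {i : ι}
    {p q : m i} (ha : π a = algebraMap R K f • matrixUnit K i p q) :
    specialize ρ π h a = algebraMap R k f • matrixUnit k i p q := by
  funext j
  ext p' q'
  rw [specialize_apply]
  rcases eq_or_ne j i with rfl | hj
  · simp only [Pi.smul_apply, Pi.single_eq_same, Matrix.smul_apply, Matrix.single_apply, smul_eq_mul]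
    split_ifs with hpq
    · rw [mul_one, ← ρ.commutes]
      congr
      simp [ha, hpq]
    · rw [mul_zero, ← map_zero ρ]
      congr
      simp [ha, hpq]
  · simp only [Pi.smul_apply, Pi.single_eq_of_ne hj, smul_zero, Matrix.zero_apply]
    rw [← map_zero ρ]
    congr
    simp [ha, Pi.single_eq_of_ne hj]

end Specialization

/-! ### Spreading out the splitting over the locus where `f` is nonzero -/

section

theorem exists_hom_of_splits {R K A : Type*} [CommRing R] [Field K] [Algebra R K] [Ring A]
    [Algebra R A] (hsplit : Splits K (K ⊗[R] A)) :
    ∃ (n : ℕ) (m : Fin n → Type) (_ : ∀ i, Fintype (m i)) (_ : ∀ i, DecidableEq (m i))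
      (_ : ∀ i, m i) (π : K ⊗[R] A →ₐ[K] ∀ i, Matrix (m i) (m i) K),
      Function.Surjective π ∧ ∀ x, π x = 0 ↔ x ∈ Ring.jacobson (K ⊗[R] A) := by
  obtain ⟨n, d, hd, ⟨φ⟩⟩ := hsplit
  refine ⟨n, fun i => Fin (d i), inferInstance, inferInstance,
    fun i => ⟨0, Nat.pos_of_ne_zero (hd i)⟩,
    φ.toAlgHom.comp (Ideal.Quotient.mkₐ K _), φ.surjective.comp Ideal.Quotient.mk_surjective, ?_⟩
  intro x
  change φ (Ideal.Quotient.mk _ x) = 0 ↔ _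
  rw [map_eq_zero_iff φ φ.injective, Ideal.Quotient.eq_zero_iff_mem]

open scoped Pointwise

/-- The elementwise form of nilpotence can be pulled back to `A` along the injection into `K ⊗ A`
and then carried over to `k ⊗ A`. -/
theorem exists_jacobson_pow_subset_zero {B : Type*} [Ring B] [IsArtinianRing B] :
    ∃ N : ℕ, (Ring.jacobson B : Set B) ^ N ⊆ {0} := by
  obtain ⟨N, hN⟩ := IsSemiprimaryRing.isNilpotent (R := B)
  have h : ∀ N : ℕ, (Ring.jacobson B : Set B) ^ N ⊆ ((Ring.jacobson B ^ N : Ideal B) : Set B) := by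
    intro N
    induction N with
    | zero =>
      rw [pow_zero, Submodule.pow_zero, Set.one_subset]
      exact Submodule.one_le.mp le_rfl
    | succ N ih =>
      rw [pow_succ, Submodule.pow_succ]
      rintro _ ⟨x, hx, y, hy, rfl⟩
      exact Submodule.mul_mem_mul (ih hx) hy
  exact ⟨N, (h N).trans (by simp [hN])⟩

variable {R : Type u} [CommRing R] [IsDomain R] {K : Type u} [Field K] [Algebra R K]
    [IsFractionRing R K] {A : Type v} [Ring A] [Algebra R A] [Module.Free R A] [Module.Finite R A]

/-- The order of quantifiers matters: `f` and the `a i` are chosen once and serve all fields `k`,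
which is what makes multiplicities over different fields comparable. -/
theorem exists_matrixQuotient (hsplit : Splits K (K ⊗[R] A)) :
    ∃ (n : ℕ) (m : Fin n → Type) (_ : ∀ i, Fintype (m i)) (_ : ∀ i, DecidableEq (m i))
      (z : ∀ i, m i) (f : R) (a : Fin n → A), f ≠ 0 ∧
      (∀ i, a i * a i = f • a i) ∧ ∀ (k : Type u) [Field k] [Algebra R k], algebraMap R k f ≠ 0 →
        Nonempty (MatrixQuotient z (algebraMap R k f) fun i => (1 : k) ⊗ₜ[R] a i) := by
  obtain ⟨n, m, _, _, z, π, hπ, hker⟩ := exists_hom_of_splits hsplit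
  have : IsArtinianRing (K ⊗[R] A) := .of_finite K _
  obtain ⟨N, hN⟩ := exists_jacobson_pow_subset_zero (B := K ⊗[R] A)
  have hinj : Function.Injective (Algebra.TensorProduct.includeRight : A →ₐ[R] K ⊗[R] A) :=
    Algebra.TensorProduct.includeRight_injective (IsFractionRing.injective R K)
  have hnil : ∀ x ∈ RingHom.ker π.toRingHom, IsNilpotent x := fun x hx =>
    ⟨N, hN (Set.pow_mem_pow ((hker x).mp hx))⟩
  choose E hE using fun q : Σ i, m i × m i =>
    hπ (matrixUnit K q.1 q.2.1 q.2.2)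
  -- Genuine idempotents are needed here, not arbitrary preimages: `e² = e` becomes the identity `a²
  -- = f a` in `A`, which persists over every `k`.
  choose e he heE using fun i =>
    exists_isIdempotentElem_eq_of_ker_isNilpotent π.toRingHom hnil (matrixUnit K i (z i) (z i))
      ⟨E ⟨i, z i, z i⟩, hE _⟩ (by simp [IsIdempotentElem, ← Pi.single_mul])
  obtain ⟨G, hG⟩ := Module.Finite.fg_top (R := R) (M := A)
  obtain ⟨s, hs⟩ := IsLocalizedModule.exist_integer_multiples_of_finite (nonZeroDivisors R)
    (TensorProduct.mk R K A 1) (Sum.elim E e)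
  obtain ⟨t, ht⟩ := IsLocalization.exist_integer_multiples_of_finite (nonZeroDivisors R)
    (fun x : G × Σ i, m i × m i =>
      π (1 ⊗ₜ[R] (x.1 : A)) x.2.1 x.2.2.1 x.2.2.2)
  -- `s` clears the denominators of the lifts `E` and `e`; `t` clears those of the matrix entries of
  -- the generators of `A`.
  set f : R := s * t with hf
  have hf0 : f ≠ 0 := nonZeroDivisors.ne_zero (s * t).2
  have hE' : ∀ q, ∃ x : A, (1 : K) ⊗ₜ[R] x = f • E q := fun q => by
    obtain ⟨x, hx⟩ := hs (Sum.inl q)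
    refine ⟨(t : R) • x, ?_⟩
    rw [TensorProduct.tmul_smul, hf, mul_comm, mul_smul]
    exact congrArg _ hx
  have he' : ∀ i, ∃ x : A, (1 : K) ⊗ₜ[R] x = f • e i := fun i => by
    obtain ⟨x, hx⟩ := hs (Sum.inr i)
    refine ⟨(t : R) • x, ?_⟩
    rw [TensorProduct.tmul_smul, hf, mul_comm, mul_smul]
    exact congrArg _ hx
  choose x hx using hE'
  choose a ha using he'
  have hG' : ∀ g ∈ G, ∀ q : Σ i, m i × m i, ∃ r : R,
      algebraMap R K r = f • π (1 ⊗ₜ[R] g) q.1 q.2.1 q.2.2 := fun g hg q => by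
    obtain ⟨r, hr⟩ := ht (⟨g, hg⟩, q)
    exact ⟨s * r, by rw [map_mul, hr, hf, mul_smul, ← Algebra.smul_def]⟩
  have haa : ∀ i, a i * a i = f • a i := fun i => hinj (by
    simp only [map_mul, map_smul, Algebra.TensorProduct.includeRight_apply, ha, smul_mul_assoc,
      mul_smul_comm, (he i).eq])
  refine ⟨n, m, inferInstance, inferInstance, z, f, a, hf0, haa, ?_⟩
  intro k _ _ hfk
  let π₀ : A →ₐ[R] ∀ i, Matrix (m i) (m i) K :=
    (π.restrictScalars R).comp Algebra.TensorProduct.includeRight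
  have hx₀ : ∀ q, π₀ (x q) = algebraMap R K f • matrixUnit K q.1 q.2.1 q.2.2 := fun q => by
    change π (1 ⊗ₜ[R] x q) = _
    rw [hx, ← algebraMap_smul K, map_smul, hE]
  have ha₀ : ∀ i, π₀ (a i) = algebraMap R K f • matrixUnit K i (z i) (z i) := fun i => by
    change π (1 ⊗ₜ[R] a i) = _
    rw [ha, ← algebraMap_smul K, map_smul]
    exact congrArg _ (heE i)
  have hpow : Submonoid.powers f ≤ nonZeroDivisors R :=
    powers_le_nonZeroDivisors_of_noZeroDivisors hf0
  -- This is `R[1/f]` inside `K`. It contains all matrix entries of the representation of `A` and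
  -- maps to every `k` in which `f` is nonzero.
  let S := Localization.subalgebra K (Submonoid.powers f) hpow
  have hS : ∀ a i p q, π₀ a i p q ∈ S := by
    intro a i p q
    have ha : a ∈ Submodule.span R (G : Set A) := hG ▸ Submodule.mem_top
    induction ha using Submodule.span_induction with
    | mem g hg =>
      obtain ⟨r, hr⟩ := hG' g hg ⟨i, p, q⟩
      refine ⟨r, f, Submonoid.mem_powers f, ?_⟩
      rw [eq_comm, IsLocalization.mk'_eq_iff_eq_mul]
      rw [hr, Algebra.smul_def, mul_comm]
      rfl
    | zero => rw [map_zero]; exact zero_mem S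
    | add x y _ _ hx hy => rw [map_add]; exact add_mem hx hy
    | smul c x _ hx => rw [map_smul]; exact S.smul_mem hx c
  let ρ : S →ₐ[R] k := IsLocalization.liftAlgHom (M := Submonoid.powers f)
    (f := Algebra.ofId R k) (by
    rintro ⟨_, l, rfl⟩
    simpa [Algebra.ofId_apply] using (IsUnit.mk0 _ hfk).pow l)
  let φ := specialize ρ π₀ hS
  have hxφ : ∀ q, φ (x q) = algebraMap R k f • matrixUnit k q.1 q.2.1 q.2.2 := fun q =>
    specialize_eq_matrixUnit ρ π₀ hS (hx₀ q)
  refine ⟨⟨AlgHom.liftEquiv R k A _ φ, ?_, ?_, hfk, ?_, ?_⟩⟩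
  · intro y
    refine ⟨∑ q : Σ i, m i × m i,
      ((algebraMap R k f)⁻¹ * y q.1 q.2.1 q.2.2) ⊗ₜ[R] x q, ?_⟩
    conv_rhs => rw [eq_sum_matrixUnit y]
    rw [map_sum]
    refine Finset.sum_congr rfl fun q _ => ?_
    rw [AlgHom.liftEquiv_tmul, hxφ, smul_smul, mul_right_comm, inv_mul_cancel₀ hfk, one_mul]
  · intro y hy
    -- The set `s` is the preimage in `A` of the Jacobson radical of `K ⊗ A`, so it inherits the
    -- exponent `N`.
    refine isNilpotent_of_lift_eq_zero φ hfk hxφ (s := {a | π₀ a = 0}) (N := N) ?_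
      (fun a ha => specialize_eq_zero ρ π₀ hS ha) hG ?_ hy
    · intro b hb
      refine hinj ?_
      rw [map_zero]
      refine hN ?_
      have h := Set.mem_image_of_mem (Algebra.TensorProduct.includeRight : A →ₐ[R] K ⊗[R] A) hb
      rw [Set.image_pow] at h
      refine Set.pow_subset_pow_left ?_ h
      rintro _ ⟨c, hc, rfl⟩
      exact (hker _).mp hc
    · intro g hg
      choose r hr using hG' g hg
      -- One factor `f` makes the matrix entries of `g` integral; the other appears because `x q`
      -- maps to `f` times a matrix unit.
      refine ⟨(f * f) • g - ∑ q, r q • x q, ?_, r, by abel⟩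
      have h1 : π₀ g = π (1 ⊗ₜ[R] g) := rfl
      rw [Set.mem_ofPred_eq, map_sub, map_sum, map_smul, sub_eq_zero]
      simp only [map_smul, hx₀, ← h1] at hr ⊢
      conv_lhs => rw [eq_sum_matrixUnit (π₀ g), Finset.smul_sum]
      refine Finset.sum_congr rfl fun q _ => ?_
      rw [← algebraMap_smul K (r q), hr, mul_smul, ← algebraMap_smul K f, ← algebraMap_smul K f,
        ← algebraMap_smul K f, smul_smul, smul_smul, smul_smul, smul_eq_mul]
      ring_nf
  · intro i
    rw [Algebra.TensorProduct.tmul_mul_tmul, haa, mul_one, TensorProduct.tmul_smul, algebraMap_smul]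
  · intro i
    rw [AlgHom.liftEquiv_tmul, one_smul]
    exact specialize_eq_matrixUnit ρ π₀ hS (ha₀ i)

end

/-! ### Free lattices over valuation rings and existence of gates -/

section Lattice

attribute [local instance] moduleOver moduleOver_isScalarTower

/-- The `S ⊗ A`-span of finitely many generators of `V` is finitely generated and torsion-free over
the valuation ring `S`, hence flat and so free. Every vector of `V` has a nonzero multiple in it, so
its localization is `V`. -/
theorem exists_lattice {R : Type u} [CommRing R] (A : Type v) [Ring A] [Algebra R A]
    [Module.Finite R A] (S K : Type u) [CommRing S] [IsDomain S] [ValuationRing S] [Algebra R S]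
    [Field K] [Algebra R K] [Algebra S K] [IsScalarTower R S K] [IsFractionRing S K]
    (V : FGModuleCat.{max u v} (K ⊗[R] A)) :
    ∃ W : FGModuleCat.{max u v} (S ⊗[R] A), IsFreeOver A S W ∧
      Nonempty (scalarExtension A S K W ≃ₗ[K ⊗[R] A] V) := by
  let ψ : S ⊗[R] A →ₐ[S] K ⊗[R] A :=
    Algebra.TensorProduct.map (Algebra.ofId S K) (AlgHom.id R A)
  have hψ : ∀ s a, ψ (s ⊗ₜ a) = algebraMap S K s ⊗ₜ a := fun s a => rfl
  let _ : Module (S ⊗[R] A) V := Module.compHom V ψ.toRingHom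
  have hsm : ∀ (b : S ⊗[R] A) (v : V), b • v = ψ b • v := fun _ _ => rfl
  let _ : Module S V := Module.compHom V (algebraMap S K)
  have : IsScalarTower S K V := .of_algebraMap_smul fun _ _ => rfl
  have : IsScalarTower S (S ⊗[R] A) V := .of_algebraMap_smul fun s v => by
    rw [hsm, ← algebraMap_smul K s v, ← algebraMap_smul (K ⊗[R] A) _ v]
    rfl
  have hK : ∀ (t : K) (v : V), t • v = (t ⊗ₜ[R] (1 : A) : K ⊗[R] A) • v := fun t v => by
    rw [← algebraMap_smul (K ⊗[R] A) t v]
    rfl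
  obtain ⟨G, hG⟩ := Module.Finite.fg_top (R := K ⊗[R] A) (M := V)
  obtain ⟨W, j, hj, hjr⟩ : ∃ (W : FGModuleCat.{max u v} (S ⊗[R] A)) (j : W →ₗ[S ⊗[R] A] V),
      Function.Injective j ∧ LinearMap.range j = Submodule.span (S ⊗[R] A) (G : Set V) := by
    have : Module.Finite (S ⊗[R] A) (Submodule.span (S ⊗[R] A) (G : Set V)) := .span_finset _ G
    exact ⟨FGModuleCat.of (S ⊗[R] A) (Submodule.span (S ⊗[R] A) (G : Set V)),
      Submodule.subtype _, Submodule.subtype_injective _, Submodule.range_subtype _⟩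
  let ι : W →ₗ[S] V := j.restrictScalars S
  have hreg : ∀ s ∈ nonZeroDivisors S, algebraMap S K s ≠ 0 := fun s hs =>
    IsFractionRing.to_map_ne_zero_of_mem_nonZeroDivisors hs
  have hcancel : ∀ s ∈ nonZeroDivisors S, ∀ v : V, s • v = 0 → v = 0 := fun s hs v hv => by
    rw [← algebraMap_smul K] at hv
    exact (smul_eq_zero.mp hv).resolve_left (hreg s hs)
  have : Module.Finite S W := .trans (S ⊗[R] A) W
  have : Module.Flat S W := by
    rw [Module.Flat.flat_iff_torsion_eq_bot_of_isBezout, eq_bot_iff]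
    rintro w ⟨⟨s, hs⟩, h⟩
    have h0 : ι (s • w) = 0 := by
      rw [show s • w = 0 from h, map_zero]
    rw [map_smul] at h0
    exact (map_eq_zero_iff j hj).mp (hcancel s hs _ h0)
  have hfree : IsFreeOver A S W := Module.free_of_flat_of_isLocalRing
  have hspan : ∀ v : V, ∃ s ∈ nonZeroDivisors S, s • v ∈ LinearMap.range j := by
    have hadd : ∀ v v' : V, (∃ s ∈ nonZeroDivisors S, s • v ∈ LinearMap.range j) →
        (∃ s ∈ nonZeroDivisors S, s • v' ∈ LinearMap.range j) →
        ∃ s ∈ nonZeroDivisors S, s • (v + v') ∈ LinearMap.range j := by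
      rintro v v' ⟨s, hs, h⟩ ⟨s', hs', h'⟩
      refine ⟨s * s', mul_mem hs hs', ?_⟩
      rw [smul_add]
      refine add_mem ?_ ?_
      · rw [mul_comm, mul_smul]
        exact Submodule.smul_of_tower_mem _ s' h
      · rw [mul_smul]
        exact Submodule.smul_of_tower_mem _ s h'
    intro v
    have hv : v ∈ Submodule.span (K ⊗[R] A) (G : Set V) := hG ▸ Submodule.mem_top
    induction hv using Submodule.span_induction with
    | mem g hg => exact ⟨1, one_mem _, by rw [one_smul, hjr]; exact Submodule.subset_span hg⟩
    | zero => exact ⟨1, one_mem _, by rw [smul_zero]; exact zero_mem _⟩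
    | add v v' _ _ h h' => exact hadd v v' h h'
    | smul c v _ h =>
      induction c using TensorProduct.induction_on with
      | zero => exact ⟨1, one_mem _, by rw [zero_smul, smul_zero]; exact zero_mem _⟩
      | add c c' hc hc' => rw [add_smul]; exact hadd _ _ hc hc'
      | tmul t a =>
        obtain ⟨s, hs, h⟩ := h
        obtain ⟨x, y, hy, rfl⟩ := IsFractionRing.div_surjective (A := S) t
        refine ⟨y * s, mul_mem hy hs, ?_⟩
        have h1 : (y * s) • ((algebraMap S K x / algebraMap S K y) ⊗ₜ[R] a : K ⊗[R] A) • v =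
            (x ⊗ₜ[R] a : S ⊗[R] A) • s • v := by
          rw [hsm, hψ, ← algebraMap_smul K s v, ← algebraMap_smul K (y * s), hK, hK, ← mul_smul,
            ← mul_smul, Algebra.TensorProduct.tmul_mul_tmul, Algebra.TensorProduct.tmul_mul_tmul,
            one_mul, mul_one, map_mul]
          congr 2
          field_simp [hreg y hy]
        rw [h1]
        exact Submodule.smul_mem _ _ h
  have hloc : IsLocalizedModule (nonZeroDivisors S) ι := by
    refine ⟨fun s => ?_, fun v => ?_, fun {x y} h => ⟨1, ?_⟩⟩
    · have h := (IsUnit.mk0 _ (hreg s s.2)).map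
        (Algebra.lsmul S S V : K →ₐ[S] Module.End S V)
      have h2 : (Algebra.lsmul S S V : K →ₐ[S] Module.End S V) (algebraMap S K s) =
          algebraMap S (Module.End S V) s := by
        ext v
        simp
      rwa [h2] at h
    · obtain ⟨s, hs, w, hw⟩ := hspan v
      exact ⟨(w, ⟨s, hs⟩), hw.symm⟩
    · rw [hj h]
  have hbc : IsBaseChange K ι := IsLocalizedModule.isBaseChange (nonZeroDivisors S) K ι
  have hlin : ∀ (b : K ⊗[R] A) (x : K ⊗[S] W),
      hbc.equiv (baseChangeAction A S K W b x) = b • hbc.equiv x := by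
    intro b x
    induction b using TensorProduct.induction_on with
    | zero => simp
    | add b c hb hc => rw [map_add, LinearMap.add_apply, map_add, hb, hc, add_smul]
    | tmul t a =>
      induction x using TensorProduct.induction_on with
      | zero => simp
      | add x y hx hy => rw [map_add, map_add, hx, hy, map_add, smul_add]
      | tmul t' w =>
        rw [baseChangeAction_tmul, hbc.equiv_tmul, hbc.equiv_tmul]
        have : ι (((1 : S) ⊗ₜ[R] a : S ⊗[R] A) • w) = ((1 : K) ⊗ₜ[R] a : K ⊗[R] A) • ι w := by
          refine (map_smul j _ w).trans ?_
          rw [hsm, hψ, map_one]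
          rfl
        rw [this, hK, hK, ← mul_smul, ← mul_smul]
        simp
  exact ⟨W, hfree, ⟨{ hbc.equiv with map_smul' := hlin }⟩⟩

end Lattice

theorem isWeakGate_of_valuationRing {R : Type u} [CommRing R] {K : Type u} [Field K] [Algebra R K]
    [IsFractionRing R K] {p : PrimeSpectrum R} (O : LocalRingAt R K p) [ValuationRing O.ring]
    (A : Type v) [Ring A] [Algebra R A] [Module.Finite R A] : IsWeakGate O A := by
  have : IsFractionRing O.ring K := by
    refine IsFractionRing.of_field _ _ fun z => ?_
    obtain ⟨x, y, -, rfl⟩ := IsFractionRing.div_surjective (A := R) z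
    exact ⟨algebraMap R O.ring x, algebraMap R O.ring y, rfl⟩
  exact fun V => exists_lattice A O.ring K V

/-- Choose a valuation ring of `K` dominating the localization of `R` at `𝔭`. Domination says that
units are reflected, which is exactly the condition that its maximal ideal contracts to `𝔭`. -/
theorem exists_localRingAt {R : Type u} [CommRing R] [IsDomain R] (K : Type u) [Field K]
    [Algebra R K] [IsFractionRing R K] (p : PrimeSpectrum R) :
    ∃ O : LocalRingAt R K p, ValuationRing O.ring := by
  have hp : p.asIdeal.primeCompl ≤ nonZeroDivisors R := p.asIdeal.primeCompl_le_nonZeroDivisors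
  let L : Subalgebra R K := Localization.subalgebra K p.asIdeal.primeCompl hp
  have hL : IsLocalization.AtPrime L p.asIdeal :=
    Localization.subalgebra.isLocalization_subalgebra K p.asIdeal.primeCompl hp
  have hloc : IsLocalRing L := IsLocalization.AtPrime.isLocalRing L p.asIdeal
  obtain ⟨B, hle, hB⟩ := (LocalSubring.mk L.toSubring
    (isLocalRing := hloc)).exists_le_valuationSubring
  let S : Subalgebra R K :=
    { B with algebraMap_mem' := fun r => hle (L.algebraMap_mem r) }
  have hval : ValuationRing S := inferInstanceAs (ValuationRing B)
  have hS : IsLocalRing S := inferInstance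
  refine ⟨⟨S, hS, ?_⟩, hval⟩
  ext r
  have hr : IsUnit (algebraMap R L r) ↔ IsUnit (algebraMap R S r) :=
    ⟨fun h => h.map (Subring.inclusion hle), fun h => hB.map_nonunit _ h⟩
  rw [Ideal.mem_comap, IsLocalRing.mem_maximalIdeal, mem_nonunits_iff, ← hr,
    IsLocalization.AtPrime.isUnit_to_map_iff L p.asIdeal]
  exact not_not

theorem LocalRingAt.isUnit_algebraMap {R : Type u} [CommRing R] {K : Type u} [Field K] [Algebra R K]
    {p : PrimeSpectrum R} (O : LocalRingAt R K p) {f : R} (hf : f ∉ p.asIdeal) :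
    IsUnit (algebraMap R O.ring f) := by
  by_contra h
  have h1 : f ∈ (IsLocalRing.maximalIdeal O.ring).comap (algebraMap R O.ring) := h
  exact hf (O.comap_maximalIdeal ▸ h1)

/-! ### Triviality of the decomposition map -/

section

variable {R : Type u} [CommRing R] {A : Type v} [Ring A] [Algebra R A] [Module.Finite R A]
  {ι : Type*} [DecidableEq ι] {m : ι → Type*} [∀ i, Fintype (m i)]
  [∀ i, DecidableEq (m i)] {z : ∀ i, m i} {f : R} {a : ι → A}

theorem multiplicity_scalarExtension {k l : Type u} [Field k] [Algebra R k] [Field l] [Algebra R l]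
    [Algebra k l] [IsScalarTower R k l] (ha : ∀ i, a i * a i = f • a i)
    (D : MatrixQuotient z (algebraMap R k f) fun i => (1 : k) ⊗ₜ[R] a i)
    (D' : MatrixQuotient z (algebraMap R l f) fun i => (1 : l) ⊗ₜ[R] a i)
    (x : G0.{max u v, max u v} (k ⊗[R] A)) :
    D'.multiplicity (G0.scalarExtension A k l x) = D.multiplicity x := by
  suffices h : D'.multiplicity.comp (G0.scalarExtension A k l) = D.multiplicity from
    DFunLike.congr_fun h x
  refine G0.addHom_ext fun V => ?_
  rw [AddMonoidHom.comp_apply, G0.scalarExtension, G0.lift_cls, MatrixQuotient.multiplicity_cls,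
    MatrixQuotient.multiplicity_cls]
  funext i
  rw [cornerRank_scalarExtension A k l _ D.ne_zero.isUnit (ha i)]
  exact @Module.Free.of_divisionRing k V _ _ (moduleOver A k V)

variable {K : Type u} [Field K] [Algebra R K] {p : PrimeSpectrum R}

/-- Generic fibre and reduction are both base changes of `W`, so each has the corner ranks of `W`.
-/
theorem multiplicity_reductionClass (O : LocalRingAt R K p) (ha : ∀ i, a i * a i = f • a i)
    (hf : f ∉ p.asIdeal)
    (D : MatrixQuotient z (algebraMap R K f) fun i => (1 : K) ⊗ₜ[R] a i)
    (D' : MatrixQuotient z (algebraMap R O.residueField f) fun i =>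
      (1 : O.residueField) ⊗ₜ[R] a i)
    {V : FGModuleCat.{max u v} (K ⊗[R] A)} {W : FGModuleCat.{max u v} (O.ring ⊗[R] A)}
    (h : IsFreeForm O A V W) :
    D'.multiplicity (reductionClass O A W) = D.multiplicity (G0.cls V) := by
  obtain ⟨hW, ⟨g⟩⟩ := h
  rw [reductionClass, MatrixQuotient.multiplicity_cls, MatrixQuotient.multiplicity_cls]
  funext i
  rw [cornerRank_scalarExtension A O.ring O.residueField hW (O.isUnit_algebraMap hf) (ha i),
    ← cornerRank_congr K _ g,
    cornerRank_scalarExtension A O.ring K hW (O.isUnit_algebraMap hf) (ha i)]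

theorem mem_decGen [IsDomain R] [IsFractionRing R K] [Fintype ι] (ha : ∀ i, a i * a i = f • a i)
    (hf : f ∉ p.asIdeal)
    (D : ∀ (k : Type u) [Field k] [Algebra R k], algebraMap R k f ≠ 0 →
      Nonempty (MatrixQuotient z (algebraMap R k f) fun i => (1 : k) ⊗ₜ[R] a i)) :
    p ∈ DecGen R K A := by
  have hK : algebraMap R K f ≠ 0 := by
    rw [Ne, FaithfulSMul.algebraMap_eq_zero_iff R K]
    rintro rfl
    exact hf (zero_mem _)
  have hp : algebraMap R p.asIdeal.ResidueField f ≠ 0 := by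
    rwa [Ne, Ideal.algebraMap_residueField_eq_zero]
  have hO : ∀ O : LocalRingAt R K p, algebraMap R O.residueField f ≠ 0 := fun O => by
    rw [IsScalarTower.algebraMap_apply R O.ring]
    exact ((O.isUnit_algebraMap hf).map _).ne_zero
  obtain ⟨DK⟩ := D K hK
  obtain ⟨Dp⟩ := D p.asIdeal.ResidueField hp
  have hres : ∀ (O : LocalRingAt R K p) (D' : MatrixQuotient z (algebraMap R O.residueField f)
      fun i => (1 : O.residueField) ⊗ₜ[R] a i) (x : G0 (p.asIdeal.ResidueField ⊗[R] A)),
      D'.multiplicity (residueExtension O A x) = Dp.multiplicity x := fun O D' x =>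
    multiplicity_scalarExtension ha Dp D' x
  constructor
  · obtain ⟨O, hval⟩ := exists_localRingAt K p
    obtain ⟨DO⟩ := D O.residueField (hO O)
    refine ⟨O, isWeakGate_of_valuationRing O A, fun W _ => ?_⟩
    -- Multiplicities identify both Grothendieck groups with `ℤ^ι` compatibly with `γ`, so `γ` is
    -- surjective and the second gate condition is automatic.
    obtain ⟨x, hx⟩ := Dp.multiplicity_bijective.2 (DO.multiplicity (reductionClass O A W))
    exact ⟨x, DO.multiplicity_bijective.1 ((hres O DO x).trans hx)⟩
  · intro O hgate
    obtain ⟨DO⟩ := D O.residueField (hO O)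
    -- This equivalence yields existence, uniqueness and triviality together. The forward direction
    -- needs a free form of every `V`, supplied by the gate; the converse needs injectivity of
    -- multiplicities over `k(𝔪)`.
    have key : ∀ d, IsDecompositionMap O A d ↔ ∀ x, Dp.multiplicity (d x) = DK.multiplicity x := by
      intro d
      constructor
      · intro hd
        suffices h : Dp.multiplicity.comp d = DK.multiplicity from DFunLike.congr_fun h
        refine G0.addHom_ext fun V => ?_
        obtain ⟨W, hW⟩ := hgate.1 V
        rw [AddMonoidHom.comp_apply, ← hres O DO, hd V W hW,
          multiplicity_reductionClass O ha hf DK DO hW]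
      · intro hd V W hW
        refine DO.multiplicity_bijective.1 ?_
        rw [hres, hd, multiplicity_reductionClass O ha hf DK DO hW]
    let e := AddEquiv.ofBijective (Dp.multiplicity) Dp.multiplicity_bijective
    refine ⟨⟨e.symm.toAddMonoidHom.comp DK.multiplicity, (key _).mpr fun x =>
      e.apply_symm_apply _, fun d hd => ?_⟩, fun d hd => ?_⟩
    · ext x
      refine Dp.multiplicity_bijective.1 (((key d).mp hd x).trans ?_)
      exact (e.apply_symm_apply _).symm
    · rw [key] at hd
      have hinj : Function.Injective d := fun x y hxy => DK.multiplicity_bijective.1 (by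
        rw [← hd, ← hd, hxy])
      have himage : d '' simpleClasses (K ⊗[R] A) = simpleClasses _ := by
        refine Dp.multiplicity_bijective.1.image_injective ?_
        rw [Set.image_image, Dp.image_simpleClasses, ← DK.image_simpleClasses]
        exact Set.image_congr fun x _ => hd x
      have hbij := hinj.injOn.bijOn_image (s := simpleClasses (K ⊗[R] A))
      rwa [himage] at hbij

end

end

end DecompositionMaps


theorem theorem2p1 (R : Type u) [CommRing R] [IsDomain R] [IsNoetherianRing R]
    (K : Type u) [Field K] [Algebra R K] [IsFractionRing R K]
    (A : Type v) [Ring A] [Algebra R A] [Module.Free R A] [Module.Finite R A]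
    (hsplit : DecompositionMaps.Splits K (K ⊗[R] A)) :
    ∃ U : Set (PrimeSpectrum R), IsOpen U ∧ ⊥ ∈ U ∧ U ⊆ DecompositionMaps.DecGen R K A := by
  obtain ⟨n, m, _, _, z, f, a, hf, ha, D⟩ := DecompositionMaps.exists_matrixQuotient hsplit
  exact ⟨PrimeSpectrum.basicOpen f, PrimeSpectrum.isOpen_basicOpen, hf,
    fun p hp => DecompositionMaps.mem_decGen ha hp D⟩
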